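/- There exist a real constant $C$ and a natural number $N$ such that the following holds for every integer $n \ge N$. Write $[n] = \{1, 2, \dots, n\}$. Let $m$ be an integer with $2m \ge \exp\bigl(C (\log\log n)^2\bigr)$, let $I, J \subseteq [n]$ each be a set of $2m$ consecutive integers, and let $S \subseteq I$ and $T \subseteq J$ be subsets with $|S| + |T| \ge 2m$. Then exactly one of the following four statements holds: 1. $S = \emptyset$; 2. $T = \emptyset$; 3. $S = I \cap 2\mathbb{Z}$ and $T = J \cap 2\mathbb{Z}$; 4. there exist $s \in S$ and $t \in T$ that are coprime. In particular, if $|S| + |T| > 2m$, then there exist $s \in S$ and $t \in T$ that are coprime. -/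

import Mathlib

/-- `A` is a set of `k` consecutive (natural) integers `a, a + 1, …, a + k - 1`. -/
def IsConsecutive (A : Finset ℕ) (k : ℕ) : Prop :=
  ∃ a : ℕ, A = Finset.Ico a (a + k)

/-! Split `S` and `T` by parity. A parity class of an interval of length `2 m` is a progression `c +
2 i`, `i < m`, and for two classes that are not both even only odd primes can be common factors. The
core claim is that index sets `A`, `B` with `|A| + |B| ≥ m`, both nonempty, give a pair without a
common odd prime.

Suppose not, with `|A| ≤ m / 2`. For `a ∈ A`, a proportion of about `f a = ∏ (1 - 1 / p)`, over the
odd primes `p ∣ c + 2 a`, of the other progression avoids these primes (`sieve_lower_bound`). All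
these terms lie outside `B`, so `m f(a) ≤ |A|` up to a small error, on all of `A`. But `1 / f` is
rarely large: the mean of its square, with the primes cut at `K ^ 2`, is below `1.88`
(`sum_inv_sq_prod_le`). Summing over `A` gives about `m² / |A| ≤ 1.88 m`, which contradicts `|A| ≤ m
/ 2` since `1.88 < 2`. A first moment would give no contradiction, hence the square.

With `K` of order `log n` and truncation level `r` of order `log log n`, the sieve error `K ^ r` is
`exp (O((log log n) ^ 2))`; this dictates the length of the intervals. -/

open Finset

/-! ### Counting multiples, truncated inclusion–exclusion, and elementary product bounds. -/

/-- An odd `d` divides `m / d + O(1)` of the `m` terms `c, c + 2, …, c + 2 (m - 1)`. -/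
lemma abs_card_filter_dvd_sub_le (c m : ℕ) {d : ℕ} (hd : Odd d) :
    |((#{i ∈ range m | d ∣ c + 2 * i} : ℕ) : ℝ) - m / d| ≤ 1 := by
  have hd0 : 0 < d := hd.pos
  obtain ⟨v, hv⟩ : ∃ v, d ∣ c + 2 * v := by
    obtain ⟨e, rfl⟩ := hd
    -- With `d = 2 e + 1`, `e` is the inverse of `-2` modulo `d`.
    exact ⟨c * e, c, by ring⟩
  have hiff : ∀ i, d ∣ c + 2 * i ↔ i ≡ v [MOD d] := by
    intro i
    have hcop : Nat.gcd d 2 = 1 := Nat.coprime_two_right.mpr hd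
    have h1 : d ∣ c + 2 * i ↔ c + 2 * i ≡ c + 2 * v [MOD d] := by
      rw [Nat.ModEq, Nat.mod_eq_zero_of_dvd hv, Nat.dvd_iff_mod_eq_zero]
    rw [h1]
    constructor
    · intro h
      exact Nat.ModEq.cancel_left_of_coprime hcop (Nat.ModEq.add_left_cancel' c h)
    · intro h
      exact Nat.ModEq.add_left c (Nat.ModEq.mul_left 2 h)
  have hcard : #{i ∈ range m | d ∣ c + 2 * i} = m / d + if v % d < m % d then 1 else 0 := by
    rw [← Nat.count_modEq_card m hd0 v, Nat.count_eq_card_filter_range]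
    simp only [hiff]
  have hdm : (m : ℝ) = d * (m / d : ℕ) + (m % d : ℕ) := by exact_mod_cast (Nat.div_add_mod m d).symm
  have hlt : ((m % d : ℕ) : ℝ) < d := by exact_mod_cast Nat.mod_lt m hd0
  have hd0' : (0 : ℝ) < d := by exact_mod_cast hd0
  have hnn : (0 : ℝ) ≤ ((m % d : ℕ) : ℝ) := by positivity
  have hq : (m : ℝ) / d = (m / d : ℕ) + ((m % d : ℕ) : ℝ) / d := by
    rw [hdm]; field_simp
  have hf1 : ((m % d : ℕ) : ℝ) / d < 1 := by rwa [div_lt_one hd0']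
  have hf0 : 0 ≤ ((m % d : ℕ) : ℝ) / d := by positivity
  rw [hcard, hq, abs_le]
  push_cast
  split_ifs <;> constructor <;> linarith

/-- Bonferroni's inequality: an inclusion–exclusion sum cut after an odd index is a lower bound. -/
lemma sum_neg_one_pow_card_le {α : Type*} [DecidableEq α] (Q : Finset α) {r : ℕ} (hr : Odd r) :
    ∑ D ∈ Q.powerset with #D ≤ r, (-1 : ℝ) ^ #D ≤ if Q = ∅ then 1 else 0 := by
  rw [sum_filter, sum_powerset_apply_card (fun k => if k ≤ r then (-1 : ℝ) ^ k else 0)]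
  rcases hq : #Q with _ | q
  · simp [card_eq_zero.mp hq]
  have hne : Q ≠ ∅ := by rintro rfl; simp at hq
  rw [if_neg hne]
  -- A partial alternating sum of a binomial row collapses to one term, of sign `(-1) ^ r`.
  have key : ∑ k ∈ range (r + 1), ((-1 : ℝ) ^ k * ((q + 1).choose k : ℕ)) =
      (-1) ^ r * (q.choose r : ℕ) := by
    exact_mod_cast Int.alternating_sum_range_choose_eq_choose (n := q) (m := r)
  have : ∑ k ∈ range (q + 1 + 1), (q + 1).choose k • (if k ≤ r then (-1 : ℝ) ^ k else 0) =
      ∑ k ∈ range (r + 1), ((-1 : ℝ) ^ k * ((q + 1).choose k : ℕ)) := by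
    have h1 : ∀ k, (q + 1).choose k • (if k ≤ r then (-1 : ℝ) ^ k else 0) =
        if k ∈ range (r + 1) then ((-1 : ℝ) ^ k * ((q + 1).choose k : ℕ)) else 0 := by
      intro k
      simp only [mem_range, Nat.lt_succ_iff, nsmul_eq_mul]
      split_ifs <;> ring
    simp only [h1]
    rw [sum_ite_mem]
    refine sum_subset inter_subset_right ?_
    intro k hk hk'
    have : q + 1 < k := by
      by_contra hcon
      exact hk' (mem_inter.mpr ⟨mem_range.mpr (by omega), hk⟩)
    simp [Nat.choose_eq_zero_of_lt this]
  rw [this, key, hr.neg_one_pow]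
  have : (0 : ℝ) ≤ (q.choose r : ℕ) := by positivity
  linarith

lemma card_lt_of_forall_lt {s : Finset ℕ} {a : ℕ} (hs : ∀ x ∈ s, 2 ≤ x) (h : ∀ x ∈ s, x < a)
    (ha : 2 ≤ a) : #s + 2 ≤ a := by
  have : s ⊆ Ico 2 a := fun x hx => mem_Ico.mpr ⟨hs x hx, h x hx⟩
  have := card_le_card this
  rw [Nat.card_Ico] at this
  omega

/-- The extreme case is `{2, …, k + 1}`, where the product telescopes. This crude bound does the
work of Mertens' theorem. -/
lemma one_div_card_add_one_le_prod (s : Finset ℕ) (hs : ∀ x ∈ s, 2 ≤ x) :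
    1 / ((#s : ℝ) + 1) ≤ ∏ p ∈ s, (1 - (p : ℝ)⁻¹) := by
  induction s using Finset.induction_on_max with
  | empty => simp
  | insert a s h ih =>
    have ha2 : 2 ≤ a := hs a (mem_insert_self _ _)
    have hs' : ∀ x ∈ s, 2 ≤ x := fun x hx => hs x (mem_insert_of_mem hx)
    have hna : a ∉ s := fun hc => lt_irrefl _ (h a hc)
    have hc : ((#s : ℝ) + 2) ≤ a := by exact_mod_cast card_lt_of_forall_lt hs' h ha2
    rw [prod_insert hna, card_insert_of_notMem hna]
    have h1 : ((#s : ℝ) + 1) / (#s + 2) ≤ 1 - (a : ℝ)⁻¹ := by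
      have : (a : ℝ)⁻¹ ≤ ((#s : ℝ) + 2)⁻¹ := by gcongr
      have h2 : ((#s : ℝ) + 1) / (#s + 2) = 1 - ((#s : ℝ) + 2)⁻¹ := by field_simp; ring
      linarith
    calc 1 / (((#s + 1 : ℕ) : ℝ) + 1) = ((#s : ℝ) + 1) / (#s + 2) * (1 / ((#s : ℝ) + 1)) := by
          push_cast; field_simp; ring
      _ ≤ _ := by
          refine mul_le_mul h1 (ih hs') (by positivity) (le_trans (by positivity) h1)

lemma prod_one_add_le_card_add_one (s : Finset ℕ) (hs : ∀ x ∈ s, 2 ≤ x) :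
    ∏ p ∈ s, (1 + (p : ℝ)⁻¹) ≤ (#s : ℝ) + 1 := by
  induction s using Finset.induction_on_max with
  | empty => simp
  | insert a s h ih =>
    have ha2 : 2 ≤ a := hs a (mem_insert_self _ _)
    have hs' : ∀ x ∈ s, 2 ≤ x := fun x hx => hs x (mem_insert_of_mem hx)
    have hna : a ∉ s := fun hc => lt_irrefl _ (h a hc)
    have hc : ((#s : ℝ) + 1) ≤ a := by
      have : ((#s : ℝ) + 2) ≤ a := by exact_mod_cast card_lt_of_forall_lt hs' h ha2
      linarith
    rw [prod_insert hna, card_insert_of_notMem hna]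
    have h1 : 1 + (a : ℝ)⁻¹ ≤ ((#s : ℝ) + 2) / (#s + 1) := by
      have : (a : ℝ)⁻¹ ≤ ((#s : ℝ) + 1)⁻¹ := by gcongr
      have h2 : ((#s : ℝ) + 2) / (#s + 1) = 1 + ((#s : ℝ) + 1)⁻¹ := by field_simp; ring
      linarith
    calc _ ≤ ((#s : ℝ) + 2) / (#s + 1) * ((#s : ℝ) + 1) := by
          refine mul_le_mul h1 (ih hs') (by positivity) (by positivity)
      _ = _ := by push_cast; field_simp; ring

/-! ### Odd prime factors and the truncated sieve. -/

/-- The odd prime divisors of `x`. -/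
def oddPrimeFactors (x : ℕ) : Finset ℕ := x.primeFactors.erase 2

lemma mem_oddPrimeFactors {x p : ℕ} :
    p ∈ oddPrimeFactors x ↔ p ≠ 2 ∧ p.Prime ∧ p ∣ x ∧ x ≠ 0 := by
  simp [oddPrimeFactors, Nat.mem_primeFactors]

lemma card_oddPrimeFactors_le {x K : ℕ} (hx : x ≠ 0) (hK : x ≤ 2 ^ K) :
    #(oddPrimeFactors x) ≤ K := by
  have h1 : #(oddPrimeFactors x) ≤ #x.primeFactors := card_le_card (erase_subset _ _)
  have h2 : 2 ^ #x.primeFactors ≤ ∏ p ∈ x.primeFactors, p :=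
    pow_card_le_prod _ _ _ fun p hp => (Nat.prime_of_mem_primeFactors hp).two_le
  have h3 : ∏ p ∈ x.primeFactors, p ≤ x :=
    Nat.le_of_dvd (Nat.pos_of_ne_zero hx) (Nat.prod_primeFactors_dvd x)
  exact h1.trans ((Nat.pow_le_pow_iff_right one_lt_two).mp (h2.trans (h3.trans hK)))

lemma prod_dvd_iff_subset_filter {P D : Finset ℕ} (hP : ∀ p ∈ P, p.Prime) (hD : D ⊆ P) (x : ℕ) :
    ∏ p ∈ D, p ∣ x ↔ D ⊆ P.filter (· ∣ x) := by
  constructor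
  · intro h p hp
    exact mem_filter.mpr ⟨hD hp, (dvd_prod_of_mem _ hp).trans h⟩
  · intro h
    exact prod_primes_dvd x (fun p hp => (hP p (hD hp)).prime) fun p hp => (mem_filter.mp (h hp)).2

lemma odd_prod_of_primes {D : Finset ℕ} (hD : ∀ p ∈ D, p.Prime ∧ p ≠ 2) : Odd (∏ p ∈ D, p) :=
  Finset.prod_induction _ Odd (fun _ _ => Odd.mul) odd_one
    fun p hp => (hD p hp).1.odd_of_ne_two (hD p hp).2

/-- Rankin's trick: weight each `D` by `K ^ (r - #D)`, which is at least `1` when `#D ≤ r`, and then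
sum over all subsets to get `K ^ r * (1 + 1 / K) ^ #P`, at most `e * K ^ r`. -/
lemma card_filter_card_le {K r : ℕ} (hK : 0 < K) {P : Finset ℕ} (hP : #P ≤ K) :
    ((#{D ∈ P.powerset | #D ≤ r} : ℕ) : ℝ) ≤ 3 * (K : ℝ) ^ r := by
  have hK' : (1 : ℝ) ≤ K := by exact_mod_cast hK
  calc ((#{D ∈ P.powerset | #D ≤ r} : ℕ) : ℝ) = ∑ D ∈ P.powerset with #D ≤ r, (1 : ℝ) := by simp
    _ ≤ ∑ D ∈ P.powerset with #D ≤ r, (K : ℝ) ^ r * ∏ p ∈ D, (K : ℝ)⁻¹ := by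
        refine sum_le_sum fun D hD => ?_
        rw [prod_const, inv_pow, ← div_eq_mul_inv, one_le_div (by positivity)]
        exact pow_le_pow_right₀ hK' (mem_filter.mp hD).2
    _ ≤ ∑ D ∈ P.powerset, (K : ℝ) ^ r * ∏ p ∈ D, (K : ℝ)⁻¹ :=
        sum_le_sum_of_subset_of_nonneg (filter_subset _ _) fun _ _ _ => by positivity
    _ = (K : ℝ) ^ r * (1 + (K : ℝ)⁻¹) ^ #P := by
        rw [← mul_sum, ← prod_one_add, prod_const]
    _ ≤ (K : ℝ) ^ r * 3 := by
        gcongr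
        calc (1 + (K : ℝ)⁻¹) ^ #P ≤ (1 + (K : ℝ)⁻¹) ^ K :=
              pow_le_pow_right₀ (by simp) hP
          _ ≤ (Real.exp (K : ℝ)⁻¹) ^ K := by
              gcongr; rw [add_comm]; exact Real.add_one_le_exp _
          _ = Real.exp 1 := by
              rw [← Real.exp_nat_mul, mul_inv_cancel₀ (by positivity)]
          _ ≤ 3 := Real.exp_one_lt_three.le
    _ = _ := by ring

/-- A truncated sieve: a lower bound for the number of terms `c + 2 i`, `i < m`, having no prime
factor in a given set `P` of at most `K` odd primes. -/
lemma sieve_lower_bound (c m : ℕ) {K r : ℕ} (hK : 0 < K) (hr : Odd r) {P : Finset ℕ}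
    (hP : ∀ p ∈ P, p.Prime ∧ p ≠ 2) (hcard : #P ≤ K) :
    m * ∏ p ∈ P, (1 - (p : ℝ)⁻¹) - m * (((K : ℝ) + 1) ^ 2 / 2 ^ r) - 3 * (K : ℝ) ^ r ≤
      (#{i ∈ range m | ∀ p ∈ P, ¬ p ∣ c + 2 * i} : ℕ) := by
  have hP1 : ∀ p ∈ P, p.Prime := fun p hp => (hP p hp).1
  have hP2 : ∀ p ∈ P, 2 ≤ p := fun p hp => (hP1 p hp).two_le
  have hprod : ∀ D : Finset ℕ, ((∏ p ∈ D, p : ℕ) : ℝ)⁻¹ = ∏ p ∈ D, (p : ℝ)⁻¹ := by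
    intro D; push_cast; rw [prod_inv_distrib]
  have step1 : ∑ D ∈ P.powerset with #D ≤ r,
      (-1 : ℝ) ^ #D * (#{i ∈ range m | ∏ p ∈ D, p ∣ c + 2 * i} : ℕ) ≤
      (#{i ∈ range m | ∀ p ∈ P, ¬ p ∣ c + 2 * i} : ℕ) := by
    have e1 : ∀ D ∈ P.powerset.filter (#· ≤ r),
        (-1 : ℝ) ^ #D * (#{i ∈ range m | ∏ p ∈ D, p ∣ c + 2 * i} : ℕ) =
        ∑ i ∈ range m, if ∏ p ∈ D, p ∣ c + 2 * i then (-1 : ℝ) ^ #D else 0 := by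
      intro D _
      rw [← sum_filter, sum_const, nsmul_eq_mul, mul_comm]
    rw [sum_congr rfl e1, sum_comm, card_filter]
    push_cast
    refine sum_le_sum fun i _ => ?_
    have e2 : ∑ D ∈ P.powerset with #D ≤ r,
        (if ∏ p ∈ D, p ∣ c + 2 * i then (-1 : ℝ) ^ #D else 0) =
        ∑ D ∈ (P.filter (· ∣ c + 2 * i)).powerset with #D ≤ r, (-1 : ℝ) ^ #D := by
      rw [← sum_filter]
      refine sum_congr ?_ fun _ _ => rfl
      ext D
      simp only [mem_filter, mem_powerset]
      constructor
      · rintro ⟨⟨h1, h2⟩, h3⟩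
        exact ⟨(prod_dvd_iff_subset_filter hP1 h1 _).mp h3, h2⟩
      · rintro ⟨h1, h2⟩
        have h3 := h1.trans (filter_subset _ _)
        exact ⟨⟨h3, h2⟩, (prod_dvd_iff_subset_filter hP1 h3 _).mpr h1⟩
    rw [e2]
    refine (sum_neg_one_pow_card_le _ hr).trans (le_of_eq ?_)
    simp only [filter_eq_empty_iff]
  -- Replacing each count by its expected value costs at most `1` per `D`.
  have step2 : ∑ D ∈ P.powerset with #D ≤ r, ((-1 : ℝ) ^ #D * (m * ∏ p ∈ D, (p : ℝ)⁻¹) - 1) ≤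
      ∑ D ∈ P.powerset with #D ≤ r,
      (-1 : ℝ) ^ #D * (#{i ∈ range m | ∏ p ∈ D, p ∣ c + 2 * i} : ℕ) := by
    refine sum_le_sum fun D hD => ?_
    have hDP := mem_powerset.mp (mem_filter.mp hD).1
    have h := abs_card_filter_dvd_sub_le c m
      (odd_prod_of_primes fun p hp => hP p (hDP hp))
    rw [div_eq_mul_inv, hprod] at h
    rw [abs_le] at h
    rcases neg_one_pow_eq_or ℝ #D with h' | h' <;> rw [h'] <;> linarith [h.1, h.2]
  have step3 : ∏ p ∈ P, (1 - (p : ℝ)⁻¹) - ((K : ℝ) + 1) ^ 2 / 2 ^ r ≤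
      ∑ D ∈ P.powerset with #D ≤ r, ((-1 : ℝ) ^ #D * ∏ p ∈ D, (p : ℝ)⁻¹) := by
    have e1 : ∏ p ∈ P, (1 - (p : ℝ)⁻¹) = ∑ D ∈ P.powerset, ((-1 : ℝ) ^ #D * ∏ p ∈ D, (p : ℝ)⁻¹) := by
      simp only [sub_eq_add_neg]
      rw [prod_one_add]
      exact sum_congr rfl fun D _ => by rw [prod_neg]
    rw [e1, ← sum_filter_add_sum_filter_not P.powerset (fun D => #D ≤ r)]
    -- The discarded tail, by Rankin's trick again: `2 ^ (#D - r) ≥ 1` there, and `1 + 2 / p ≤ (1 +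
    -- 1 / p) ^ 2`.
    have e2 : ∑ D ∈ P.powerset with ¬ #D ≤ r, ((-1 : ℝ) ^ #D * ∏ p ∈ D, (p : ℝ)⁻¹) ≤
        ((K : ℝ) + 1) ^ 2 / 2 ^ r := by
      calc _ ≤ ∑ D ∈ P.powerset with ¬ #D ≤ r, (∏ p ∈ D, (2 * (p : ℝ)⁻¹)) / 2 ^ r := by
            refine sum_le_sum fun D hD => ?_
            have hlt : r < #D := by simpa using (mem_filter.mp hD).2
            have hnn : 0 ≤ ∏ p ∈ D, (p : ℝ)⁻¹ := by positivity
            have h2 : (1 : ℝ) ≤ 2 ^ #D / 2 ^ r := by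
              rw [one_le_div (by positivity)]
              exact pow_le_pow_right₀ (by norm_num) hlt.le
            have h1 : (-1 : ℝ) ^ #D ≤ 1 := by
              rcases neg_one_pow_eq_or ℝ #D with h' | h' <;> rw [h']; norm_num
            rw [prod_mul_distrib, prod_const, mul_div_right_comm]
            exact mul_le_mul_of_nonneg_right (h1.trans h2) hnn
        _ ≤ ∑ D ∈ P.powerset, (∏ p ∈ D, (2 * (p : ℝ)⁻¹)) / 2 ^ r :=
            sum_le_sum_of_subset_of_nonneg (filter_subset _ _) fun _ _ _ => by positivity
        _ = (∏ p ∈ P, (1 + 2 * (p : ℝ)⁻¹)) / 2 ^ r := by rw [← sum_div, ← prod_one_add]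
        _ ≤ (∏ p ∈ P, (1 + (p : ℝ)⁻¹) ^ 2) / 2 ^ r := by
            gcongr with p hp
            nlinarith [sq_nonneg ((p : ℝ)⁻¹)]
        _ ≤ ((K : ℝ) + 1) ^ 2 / 2 ^ r := by
            rw [prod_pow]
            gcongr
            refine (prod_one_add_le_card_add_one P hP2).trans ?_
            gcongr
    linarith
  have step4 : ∑ D ∈ P.powerset with #D ≤ r, ((-1 : ℝ) ^ #D * (m * ∏ p ∈ D, (p : ℝ)⁻¹) - 1) =
      m * (∑ D ∈ P.powerset with #D ≤ r, ((-1 : ℝ) ^ #D * ∏ p ∈ D, (p : ℝ)⁻¹)) -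
      (#{D ∈ P.powerset | #D ≤ r} : ℕ) := by
    rw [sum_sub_distrib, mul_sum, sum_const, nsmul_eq_mul, mul_one]
    congr 1
    exact sum_congr rfl fun D _ => by ring
  have step5 := card_filter_card_le (r := r) hK hcard
  have step6 := mul_le_mul_of_nonneg_left step3 (Nat.cast_nonneg (α := ℝ) m)
  rw [mul_sub] at step6
  linarith

/-! ### Second moment of `∏ p / (p - 1)` over small primes. -/

/-- The odd primes up to `z`. -/
def oddPrimesLE (z : ℕ) : Finset ℕ := {p ∈ range (z + 1) | p.Prime ∧ p ≠ 2}

lemma mem_oddPrimesLE {z p : ℕ} : p ∈ oddPrimesLE z ↔ p ≤ z ∧ p.Prime ∧ p ≠ 2 := by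
  simp [oddPrimesLE]

lemma card_oddPrimesLE_le (z : ℕ) : #(oddPrimesLE z) ≤ z := by
  have : oddPrimesLE z ⊆ Icc 1 z := fun p hp => by
    have := mem_oddPrimesLE.mp hp
    exact mem_Icc.mpr ⟨this.2.1.one_le, this.1⟩
  simpa using card_le_card this

/-- Telescoping over odd numbers: the factor at `a` is at most `(1 + 1 / (a - 3)) / (1 + 1 / (a -
1))`. The extra factor in `b` carries the induction, and `9 / 8` is `1 + 1 / (11 - 3)`. -/
lemma prod_odd_tail_le (T : Finset ℕ) (hT : ∀ k ∈ T, Odd k ∧ 11 ≤ k) (b : ℕ) (hb : Odd b)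
    (hb11 : 11 ≤ b) (hTb : ∀ k ∈ T, k < b) :
    (∏ k ∈ T, (1 + (((1 - (k : ℝ)⁻¹) ^ 2)⁻¹ - 1) * (k : ℝ)⁻¹)) * (1 + 1 / ((b : ℝ) - 3)) ≤
      9 / 8 := by
  induction T using Finset.induction_on_max generalizing b with
  | empty =>
    have : (11 : ℝ) ≤ b := by exact_mod_cast hb11
    have : 1 / ((b : ℝ) - 3) ≤ 1 / 8 := by
      apply one_div_le_one_div_of_le <;> linarith
    simp only [prod_empty]; linarith
  | insert a s h ih =>
    have hna : a ∉ s := fun hc => lt_irrefl _ (h a hc)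
    obtain ⟨hao, ha11⟩ := hT a (mem_insert_self _ _)
    have hab : a + 2 ≤ b := by
      have := hTb a (mem_insert_self _ _)
      obtain ⟨u, rfl⟩ := hao
      obtain ⟨v, rfl⟩ := hb
      omega
    have ih' := ih (fun k hk => hT k (mem_insert_of_mem hk)) a hao ha11 h
    have ha : (11 : ℝ) ≤ a := by exact_mod_cast ha11
    have hab' : (a : ℝ) + 2 ≤ b := by exact_mod_cast hab
    rw [prod_insert hna]
    have hg : (1 + (((1 - (a : ℝ)⁻¹) ^ 2)⁻¹ - 1) * (a : ℝ)⁻¹) * (1 + 1 / ((b : ℝ) - 3)) ≤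
        1 + 1 / ((a : ℝ) - 3) := by
      have h1 : 1 + 1 / ((b : ℝ) - 3) ≤ 1 + 1 / ((a : ℝ) - 1) := by
        have : 1 / ((b : ℝ) - 3) ≤ 1 / ((a : ℝ) - 1) := by
          apply one_div_le_one_div_of_le <;> linarith
        linarith
      have h2 : 1 + (((1 - (a : ℝ)⁻¹) ^ 2)⁻¹ - 1) * (a : ℝ)⁻¹ =
          1 + (2 * a - 1) / (a * ((a : ℝ) - 1) ^ 2) := by
        have : (a : ℝ) - 1 ≠ 0 := by linarith
        have h0 : (a : ℝ) ≠ 0 := by linarith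
        have : 1 - (a : ℝ)⁻¹ = (a - 1) / a := by field_simp
        rw [this]
        field_simp
        ring
      have h3 : (0 : ℝ) ≤ (2 * a - 1) / (a * ((a : ℝ) - 1) ^ 2) := by
        apply div_nonneg
        · linarith
        · positivity
      rw [h2]
      calc _ ≤ (1 + (2 * a - 1) / (a * ((a : ℝ) - 1) ^ 2)) * (1 + 1 / ((a : ℝ) - 1)) := by
            gcongr
        _ ≤ 1 + 1 / ((a : ℝ) - 3) := by
            have ha1 : 0 < (a : ℝ) - 1 := by linarith
            have ha3 : 0 < (a : ℝ) - 3 := by linarith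
            have e1 : (1 + (2 * a - 1) / (a * ((a : ℝ) - 1) ^ 2)) * (1 + 1 / ((a : ℝ) - 1)) =
                ((a : ℝ) ^ 3 - 2 * a ^ 2 + 3 * a - 1) / (a - 1) ^ 3 := by field_simp; ring
            have e2 : 1 + 1 / ((a : ℝ) - 3) = (a - 2) / (a - 3) := by field_simp; ring
            rw [e1, e2, div_le_div_iff₀ (by positivity) ha3]
            nlinarith
    have hnn : 0 ≤ ∏ k ∈ s, (1 + (((1 - (k : ℝ)⁻¹) ^ 2)⁻¹ - 1) * (k : ℝ)⁻¹) := by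
      refine prod_nonneg fun k hk => ?_
      have hk11 : (11 : ℝ) ≤ k := by exact_mod_cast (hT k (mem_insert_of_mem hk)).2
      have h1 : (k : ℝ)⁻¹ ≤ 1 / 11 := by
        rw [inv_eq_one_div]; apply one_div_le_one_div_of_le <;> linarith
      have h0 : 0 ≤ (k : ℝ)⁻¹ := by positivity
      have : 1 ≤ ((1 - (k : ℝ)⁻¹) ^ 2)⁻¹ := by
        apply (one_le_inv₀ _).mpr <;> nlinarith
      nlinarith
    calc _ = (∏ k ∈ s, (1 + (((1 - (k : ℝ)⁻¹) ^ 2)⁻¹ - 1) * (k : ℝ)⁻¹)) *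
          ((1 + (((1 - (a : ℝ)⁻¹) ^ 2)⁻¹ - 1) * (a : ℝ)⁻¹) * (1 + 1 / ((b : ℝ) - 3))) := by ring
      _ ≤ _ := mul_le_mul_of_nonneg_left hg hnn
      _ ≤ _ := ih'

/-- What matters is a bound below `2` with room to spare. The factors at `3, 5, 7` are computed
exactly; from `11` on, the telescoping bound for odd numbers suffices. -/
lemma prod_oddPrimesLE_le (z : ℕ) :
    ∏ p ∈ oddPrimesLE z, (1 + (((1 - (p : ℝ)⁻¹) ^ 2)⁻¹ - 1) * (p : ℝ)⁻¹) ≤ 187 / 100 := by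
  set u : ℕ → ℝ := fun p => 1 + (((1 - (p : ℝ)⁻¹) ^ 2)⁻¹ - 1) * (p : ℝ)⁻¹ with hu
  have hu1 : ∀ p, 2 ≤ p → 1 ≤ u p := by
    intro p hp
    have hp' : (2 : ℝ) ≤ p := by exact_mod_cast hp
    have h1 : (p : ℝ)⁻¹ ≤ 1 / 2 := by
      rw [inv_eq_one_div]; apply one_div_le_one_div_of_le <;> linarith
    have h0 : 0 ≤ (p : ℝ)⁻¹ := by positivity
    have : 1 ≤ ((1 - (p : ℝ)⁻¹) ^ 2)⁻¹ := by
      apply (one_le_inv₀ _).mpr <;> nlinarith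
    simp only [hu]; nlinarith
  rw [← prod_filter_mul_prod_filter_not (oddPrimesLE z) (fun p => p < 11)]
  have htail : ∏ p ∈ oddPrimesLE z with ¬ p < 11, u p ≤ 9 / 8 := by
    have h := prod_odd_tail_le {p ∈ oddPrimesLE z | ¬ p < 11} (fun k hk => by
      obtain ⟨h1, h2⟩ := mem_filter.mp hk
      obtain ⟨_, h3, h4⟩ := mem_oddPrimesLE.mp h1
      exact ⟨h3.odd_of_ne_two h4, by omega⟩) (2 * z + 11) ⟨z + 5, by ring⟩ (by omega) (fun k hk => by
      have := (mem_oddPrimesLE.mp (mem_filter.mp hk).1).1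
      omega)
    refine le_trans ?_ h
    refine le_mul_of_one_le_right (prod_nonneg fun p hp => ?_) ?_
    · exact zero_le_one.trans
        (hu1 p (mem_oddPrimesLE.mp (mem_filter.mp hp).1).2.1.two_le)
    · have : (0 : ℝ) ≤ 1 / (((2 * z + 11 : ℕ) : ℝ) - 3) := by
        apply div_nonneg zero_le_one
        push_cast
        have : (0 : ℝ) ≤ z := by positivity
        linarith
      linarith
  have hhead : ∏ p ∈ oddPrimesLE z with p < 11, u p ≤ u 3 * u 5 * u 7 := by
    have hsub : {p ∈ oddPrimesLE z | p < 11} ⊆ ({3, 5, 7} : Finset ℕ) := by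
      intro p hp
      obtain ⟨h1, h2⟩ := mem_filter.mp hp
      obtain ⟨_, h3, h4⟩ := mem_oddPrimesLE.mp h1
      interval_cases p <;> first
        | (exfalso; revert h3; norm_num; done)
        | exact absurd rfl h4
        | simp
    rw [← mul_one (∏ p ∈ oddPrimesLE z with p < 11, u p)]
    have h357 : u 3 * u 5 * u 7 = ∏ p ∈ ({3, 5, 7} : Finset ℕ), u p := by
      simp [prod_insert, mul_assoc]
    rw [h357, ← prod_sdiff hsub, mul_comm]
    gcongr
    · refine prod_nonneg fun p hp => ?_
      exact zero_le_one.trans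
        (hu1 p (mem_oddPrimesLE.mp (mem_filter.mp hp).1).2.1.two_le)
    · rw [← prod_const_one (s := ({3, 5, 7} : Finset ℕ) \ {p ∈ oddPrimesLE z | p < 11})]
      refine prod_le_prod (fun _ _ => zero_le_one) fun p hp => hu1 p ?_
      have := (mem_sdiff.mp hp).1
      simp only [mem_insert, mem_singleton] at this
      omega
  have hnn : 0 ≤ ∏ p ∈ oddPrimesLE z with ¬ p < 11, u p := prod_nonneg fun p hp =>
    zero_le_one.trans (hu1 p (mem_oddPrimesLE.mp (mem_filter.mp hp).1).2.1.two_le)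
  have h357 : u 3 * u 5 * u 7 = 17 / 12 * (89 / 80) * (265 / 252) := by
    simp only [hu]; norm_num
  calc _ ≤ (u 3 * u 5 * u 7) * (9 / 8) := by
        refine mul_le_mul hhead htail hnn ?_
        rw [h357]; norm_num
    _ ≤ _ := by rw [h357]; norm_num

/-- The second moment of `∏ p / (p - 1)`, taken over the odd primes `p ≤ z` dividing `c + 2 i`. -/
lemma sum_inv_sq_prod_le (c m z : ℕ) :
    ∑ i ∈ range m, ((∏ p ∈ oddPrimesLE z with p ∣ c + 2 * i, (1 - (p : ℝ)⁻¹)) ^ 2)⁻¹ ≤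
      187 / 100 * m + ((z : ℝ) + 1) ^ 2 := by
  set P := oddPrimesLE z
  set g : ℕ → ℝ := fun p => ((1 - (p : ℝ)⁻¹) ^ 2)⁻¹ - 1 with hg
  have hP : ∀ p ∈ P, p.Prime ∧ p ≠ 2 := fun p hp => (mem_oddPrimesLE.mp hp).2
  have hg0 : ∀ p ∈ P, 0 ≤ g p := by
    intro p hp
    have hp' : (2 : ℝ) ≤ p := by exact_mod_cast (hP p hp).1.two_le
    have h1 : (p : ℝ)⁻¹ ≤ 1 / 2 := by
      rw [inv_eq_one_div]; apply one_div_le_one_div_of_le <;> linarith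
    have h0 : 0 ≤ (p : ℝ)⁻¹ := by positivity
    have : 1 ≤ ((1 - (p : ℝ)⁻¹) ^ 2)⁻¹ := by
      apply (one_le_inv₀ _).mpr <;> nlinarith
    simp only [hg]; linarith
  -- Expanding `∏ (1 + g p)` over sets `D` of primes turns the moment into a weighted count of
  -- multiples of `∏ D`.
  have e1 : ∀ i, ((∏ p ∈ P with p ∣ c + 2 * i, (1 - (p : ℝ)⁻¹)) ^ 2)⁻¹ =
      ∑ D ∈ P.powerset, if ∏ p ∈ D, p ∣ c + 2 * i then ∏ p ∈ D, g p else 0 := by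
    intro i
    rw [← prod_pow, ← prod_inv_distrib]
    have : ∏ p ∈ P with p ∣ c + 2 * i, ((1 - (p : ℝ)⁻¹) ^ 2)⁻¹ =
        ∏ p ∈ P with p ∣ c + 2 * i, (1 + g p) := prod_congr rfl fun p _ => by simp [hg]
    rw [this, prod_one_add, ← sum_filter]
    refine sum_congr ?_ fun _ _ => rfl
    ext D
    simp only [mem_filter, mem_powerset]
    constructor
    · intro h
      have h3 := h.trans (filter_subset _ _)
      exact ⟨h3, (prod_dvd_iff_subset_filter (fun p hp => (hP p hp).1) h3 _).mpr h⟩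
    · rintro ⟨h1, h2⟩
      exact (prod_dvd_iff_subset_filter (fun p hp => (hP p hp).1) h1 _).mp h2
  simp only [e1]
  rw [sum_comm]
  calc ∑ D ∈ P.powerset, ∑ i ∈ range m, (if ∏ p ∈ D, p ∣ c + 2 * i then ∏ p ∈ D, g p else 0)
      ≤ ∑ D ∈ P.powerset, (m * ∏ p ∈ D, (g p * (p : ℝ)⁻¹) + ∏ p ∈ D, g p) := by
        refine sum_le_sum fun D hD => ?_
        have hDP := mem_powerset.mp hD
        rw [← sum_filter, sum_const, nsmul_eq_mul]
        have h := (abs_le.mp (abs_card_filter_dvd_sub_le c m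
          (odd_prod_of_primes fun p hp => hP p (hDP hp)))).2
        have hnn : 0 ≤ ∏ p ∈ D, g p := prod_nonneg fun p hp => hg0 p (hDP hp)
        have h2 := mul_le_mul_of_nonneg_right h hnn
        rw [prod_mul_distrib, prod_inv_distrib, ← Nat.cast_prod]
        rw [div_eq_mul_inv] at h2
        linarith
    _ = m * ∏ p ∈ P, (1 + g p * (p : ℝ)⁻¹) + ∏ p ∈ P, (1 + g p) := by
        rw [sum_add_distrib, ← mul_sum, ← prod_one_add, ← prod_one_add]
    _ ≤ m * (187 / 100) + ((z : ℝ) + 1) ^ 2 := by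
        -- The second summand collects the rounding errors over all `D`; the cut at `z` keeps it
        -- polynomial in `z`.
        refine add_le_add (mul_le_mul_of_nonneg_left (prod_oddPrimesLE_le z) (by positivity)) ?_
        have h1 : ∏ p ∈ P, (1 + g p) = ((∏ p ∈ P, (1 - (p : ℝ)⁻¹)) ^ 2)⁻¹ := by
          rw [← prod_pow, ← prod_inv_distrib]
          exact prod_congr rfl fun p _ => by simp [hg]
        have h2 := one_div_card_add_one_le_prod P fun p hp => (hP p hp).1.two_le
        have hz : (#P : ℝ) ≤ z := by exact_mod_cast card_oddPrimesLE_le z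
        have h3 : 1 / ((z : ℝ) + 1) ≤ ∏ p ∈ P, (1 - (p : ℝ)⁻¹) := le_trans (by gcongr) h2
        rw [h1, ← inv_inv (((z : ℝ) + 1) ^ 2)]
        gcongr
        rw [← inv_pow, ← one_div]
        gcongr
    _ = _ := by ring

/-- Primes above `K ^ 2` are negligible: `x` has at most `K` of them, so by Bernoulli they
contribute at least `(1 - 1 / K ^ 2) ^ K ≥ 1 - 1 / K`. -/
lemma mul_prod_oddPrimesLE_le_prod_oddPrimeFactors {x K : ℕ} (hK : 2 ≤ K) (hx : x ≠ 0)
    (hxK : x ≤ 2 ^ K) :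
    (1 - (K : ℝ)⁻¹) * ∏ p ∈ oddPrimesLE (K ^ 2) with p ∣ x, (1 - (p : ℝ)⁻¹) ≤
      ∏ p ∈ oddPrimeFactors x, (1 - (p : ℝ)⁻¹) := by
  have hK' : (2 : ℝ) ≤ K := by exact_mod_cast hK
  have hp1 : ∀ p ∈ oddPrimeFactors x, (p : ℝ)⁻¹ ≤ 1 := fun p hp => by
    have : 1 ≤ p := (mem_oddPrimeFactors.mp hp).2.1.one_le
    exact inv_le_one_of_one_le₀ (by exact_mod_cast this)
  have heq : {p ∈ oddPrimesLE (K ^ 2) | p ∣ x} = {p ∈ oddPrimeFactors x | p ≤ K ^ 2} := by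
    ext p
    simp only [mem_filter, mem_oddPrimesLE, mem_oddPrimeFactors]
    tauto
  rw [heq, ← prod_filter_mul_prod_filter_not (oddPrimeFactors x) (fun p => p ≤ K ^ 2), mul_comm]
  refine mul_le_mul_of_nonneg_left ?_
    (prod_nonneg fun p hp => sub_nonneg.mpr (hp1 p (mem_filter.mp hp).1))
  have hcard : #{p ∈ oddPrimeFactors x | ¬ p ≤ K ^ 2} ≤ K :=
    (card_le_card (filter_subset _ _)).trans (card_oddPrimeFactors_le hx hxK)
  have hinv : ((K : ℝ) ^ 2)⁻¹ ≤ 1 := inv_le_one_of_one_le₀ (by nlinarith)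
  calc 1 - (K : ℝ)⁻¹ = 1 + (K : ℝ) * (-((K : ℝ) ^ 2)⁻¹) := by field_simp; ring
    _ ≤ (1 + -((K : ℝ) ^ 2)⁻¹) ^ K := one_add_mul_le_pow (by linarith) K
    _ = (1 - ((K : ℝ) ^ 2)⁻¹) ^ K := by rw [← sub_eq_add_neg]
    _ ≤ (1 - ((K : ℝ) ^ 2)⁻¹) ^ #{p ∈ oddPrimeFactors x | ¬ p ≤ K ^ 2} :=
        pow_le_pow_of_le_one (by linarith) (by simp) hcard
    _ = ∏ p ∈ oddPrimeFactors x with ¬ p ≤ K ^ 2, (1 - ((K : ℝ) ^ 2)⁻¹) := by rw [prod_const]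
    _ ≤ ∏ p ∈ oddPrimeFactors x with ¬ p ≤ K ^ 2, (1 - (p : ℝ)⁻¹) := by
        refine prod_le_prod (fun _ _ => by linarith) fun p hp => ?_
        have h : K ^ 2 ≤ p := (not_le.mp (mem_filter.mp hp).2).le
        have h' : (K : ℝ) ^ 2 ≤ p := by exact_mod_cast h
        gcongr

/-! ### The sieve against the second moment. -/

/-- If `A` and `B` are sets of indices with `|A| ≤ m / 2` and `|A| + |B| ≥ m`, then some terms
`c + 2 a` and `c' + 2 b` have no common odd prime factor. -/
lemma exists_no_common_odd_prime_of_card_le {K r m c c' : ℕ} (hK : 1000 ≤ K) (hr : Odd r)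
    (h1 : ((K : ℝ) + 1) ^ 2 / 2 ^ r ≤ 1 / (2 * K ^ 2))
    (h2 : 3 * (K : ℝ) ^ r ≤ m / (2 * K ^ 2)) (h3 : ((K : ℝ) ^ 2 + 1) ^ 2 ≤ m / 100)
    (hc : 1 ≤ c) (hcK : ∀ i < m, c + 2 * i ≤ 2 ^ K) {A B : Finset ℕ} (hA : A ⊆ range m)
    (hB : B ⊆ range m) (hA0 : A.Nonempty) (hAm : 2 * #A ≤ m) (hAB : m ≤ #A + #B) :
    ∃ a ∈ A, ∃ b ∈ B, ∀ p : ℕ, p.Prime → p ≠ 2 → p ∣ c + 2 * a → ¬ p ∣ c' + 2 * b := by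
  by_contra! hcon
  have hK' : (1000 : ℝ) ≤ K := by exact_mod_cast hK
  have hm : (0 : ℝ) < m := by
    have : (0 : ℝ) < ((K : ℝ) ^ 2 + 1) ^ 2 := by positivity
    linarith
  set f : ℕ → ℝ := fun a => ∏ p ∈ oddPrimeFactors (c + 2 * a), (1 - (p : ℝ)⁻¹) with hf
  set F : ℕ → ℝ := fun a => ∏ p ∈ oddPrimesLE (K ^ 2) with p ∣ c + 2 * a, (1 - (p : ℝ)⁻¹) with hF
  have hFpos : ∀ a, 0 < F a := by
    intro a
    refine prod_pos fun p hp => ?_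
    have hp1 : 1 < p := (mem_oddPrimesLE.mp (mem_filter.mp hp).1).2.1.one_lt
    have : (p : ℝ)⁻¹ < 1 := inv_lt_one_of_one_lt₀ (by exact_mod_cast hp1)
    linarith
  -- The survivors of the sieve by the primes of `c + 2 * a` are disjoint from `B`, so they number
  -- at most `m - #B ≤ #A`.
  have hcount : ∀ a ∈ A, m * f a - m / (K : ℝ) ^ 2 ≤ #A := by
    intro a ha
    have ham : a < m := mem_range.mp (hA ha)
    have hprime : ∀ p ∈ oddPrimeFactors (c + 2 * a), p.Prime ∧ p ≠ 2 := fun p hp =>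
      ⟨(mem_oddPrimeFactors.mp hp).2.1, (mem_oddPrimeFactors.mp hp).1⟩
    have hs := sieve_lower_bound c' m (by omega) hr hprime
      (card_oddPrimeFactors_le (x := c + 2 * a) (K := K) (by omega) (hcK a ham))
    have hdisj : Disjoint {i ∈ range m | ∀ p ∈ oddPrimeFactors (c + 2 * a), ¬ p ∣ c' + 2 * i} B := by
      rw [Finset.disjoint_left]
      intro b hb hbB
      obtain ⟨p, hp, hp2, hpa, hpb⟩ := hcon a ha b hbB
      exact (mem_filter.mp hb).2 p (mem_oddPrimeFactors.mpr ⟨hp2, hp, hpa, by omega⟩) hpb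
    have hle := card_le_card (union_subset
      (filter_subset (fun i => ∀ p ∈ oddPrimeFactors (c + 2 * a), ¬ p ∣ c' + 2 * i) (range m)) hB)
    rw [card_union_of_disjoint hdisj, card_range] at hle
    have hle' : #{i ∈ range m | ∀ p ∈ oddPrimeFactors (c + 2 * a), ¬ p ∣ c' + 2 * i} ≤ #A := by
      omega
    have hle'' : ((#{i ∈ range m | ∀ p ∈ oddPrimeFactors (c + 2 * a), ¬ p ∣ c' + 2 * i} : ℕ) : ℝ) ≤
      #A := by exact_mod_cast hle'
    have h4 := mul_le_mul_of_nonneg_left h1 hm.le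
    have h5 : (m : ℝ) / K ^ 2 = m * (1 / (2 * K ^ 2)) + m / (2 * K ^ 2) := by field_simp; norm_num
    simp only [hf]
    linarith
  -- Since `f a ≥ 1 / (K + 1)`, a single element already forces `#A` to be of order at least `m /
  -- K`, so the sieve error is small relative to `#A`.
  have herr : (m : ℝ) / K ^ 2 ≤ #A / 100 := by
    obtain ⟨a, ha⟩ := hA0
    have ham : a < m := mem_range.mp (hA ha)
    have hlow : 1 / ((K : ℝ) + 1) ≤ f a := by
      have hcard := card_oddPrimeFactors_le (x := c + 2 * a) (K := K) (by omega) (hcK a ham)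
      have hcard' : (#(oddPrimeFactors (c + 2 * a)) : ℝ) ≤ K := by exact_mod_cast hcard
      refine le_trans ?_ (one_div_card_add_one_le_prod _ fun p hp =>
        (mem_oddPrimeFactors.mp hp).2.1.two_le)
      gcongr
    have h4 := hcount a ha
    have h5 := mul_le_mul_of_nonneg_left hlow hm.le
    have h6 : (101 : ℝ) / K ^ 2 ≤ 1 / ((K : ℝ) + 1) := by
      rw [div_le_div_iff₀ (by positivity) (by positivity)]
      nlinarith
    have h7 := mul_le_mul_of_nonneg_left h6 hm.le
    have h8 : (m : ℝ) * (101 / K ^ 2) = 101 * (m / K ^ 2) := by ring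
    linarith
  have hFle : ∀ a ∈ A, m * F a ≤ 102 / 100 * #A := by
    intro a ha
    have ham : a < m := mem_range.mp (hA ha)
    have h4 := mul_prod_oddPrimesLE_le_prod_oddPrimeFactors (x := c + 2 * a) (K := K) (by omega)
      (by omega) (hcK a ham)
    have h5 : m * f a ≤ 101 / 100 * #A := by linarith [hcount a ha]
    have h6 : (K : ℝ)⁻¹ ≤ 1 / 1000 := by
      rw [inv_eq_one_div]; apply one_div_le_one_div_of_le <;> linarith
    have h7 : 999 / 1000 * F a ≤ f a := by
      refine le_trans ?_ h4
      exact mul_le_mul_of_nonneg_right (by linarith) (hFpos a).le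
    have h8 := mul_le_mul_of_nonneg_left h7 hm.le
    have h9 : (0 : ℝ) ≤ #A := by positivity
    linarith
  have hsum : ∑ a ∈ A, ((F a) ^ 2)⁻¹ ≤ 188 / 100 * m := by
    have h4 := sum_inv_sq_prod_le c m (K ^ 2)
    push_cast at h4
    calc ∑ a ∈ A, ((F a) ^ 2)⁻¹ ≤ ∑ a ∈ range m, ((F a) ^ 2)⁻¹ :=
          sum_le_sum_of_subset_of_nonneg hA fun _ _ _ => by positivity
      _ ≤ 188 / 100 * m := by simp only [hF]; linarith
  have hA1 : (0 : ℝ) < #A := by exact_mod_cast hA0.card_pos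
  have hlow : (#A : ℝ) * ((102 / 100 * (#A : ℝ) / m) ^ 2)⁻¹ ≤ ∑ a ∈ A, ((F a) ^ 2)⁻¹ := by
    rw [← nsmul_eq_mul, ← sum_const]
    refine sum_le_sum fun a ha => ?_
    have := hFpos a
    have h4 : F a ≤ 102 / 100 * #A / m := by
      rw [le_div_iff₀ hm, mul_comm]; exact hFle a ha
    gcongr
  have h4 := hlow.trans hsum
  have h5 : (#A : ℝ) * ((102 / 100 * (#A : ℝ) / m) ^ 2)⁻¹ = m ^ 2 / ((102 / 100) ^ 2 * #A) := by
    field_simp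
  rw [h5, div_le_iff₀ (by positivity)] at h4
  have h6 : (2 : ℝ) * #A ≤ m := by exact_mod_cast hAm
  -- The numerical contradiction is `1.88 * 1.02 ^ 2 < 2`.
  nlinarith

/-- The symmetric form, for intervals of length at least `exp (300 (log log n) ^ 2)`. -/
lemma exists_no_common_odd_prime {n m c c' : ℕ} (hn : 2 ^ 1024 ≤ n)
    (hm : Real.exp (300 * (Real.log (Real.log (n : ℝ))) ^ 2) ≤ ((2 * m : ℕ) : ℝ))
    (hc : 1 ≤ c) (hc' : 1 ≤ c') (hcn : ∀ i < m, c + 2 * i ≤ n) (hcn' : ∀ i < m, c' + 2 * i ≤ n)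
    {A B : Finset ℕ} (hA : A ⊆ range m) (hB : B ⊆ range m) (hA0 : A.Nonempty) (hB0 : B.Nonempty)
    (hAB : m ≤ #A + #B) :
    ∃ a ∈ A, ∃ b ∈ B, ∀ p : ℕ, p.Prime → p ≠ 2 → p ∣ c + 2 * a → ¬ p ∣ c' + 2 * b := by
  obtain ⟨l, hl, hnl, hlm⟩ : ∃ l : ℕ, 10 ≤ l ∧ n ≤ 2 ^ 2 ^ l ∧ 2 ^ (11 * l ^ 2) ≤ 2 * m := by
    set k := Nat.log 2 n with hk
    have hn0 : n ≠ 0 := (lt_of_lt_of_le (Nat.two_pow_pos 1024) hn).ne'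
    have hk1 : 1024 ≤ k := Nat.le_log_of_pow_le one_lt_two hn
    have hkn : 2 ^ k ≤ n := Nat.pow_log_le_self 2 hn0
    have hnk : n < 2 ^ (k + 1) := Nat.lt_pow_succ_log_self one_lt_two n
    set j := Nat.log 2 k with hj
    have hj1 : 10 ≤ j := Nat.le_log_of_pow_le one_lt_two (by norm_num; exact hk1)
    have hjk : 2 ^ j ≤ k := Nat.pow_log_le_self 2 (by omega)
    have hkj : k < 2 ^ (j + 1) := Nat.lt_pow_succ_log_self one_lt_two k
    -- Here `j` is the integer part of `log₂ log₂ n`. As `log log n ≥ l / 2` for `l = j + 1`, the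
    -- constant `300` gives an exponent of at least `75 l ^ 2`, ample for `11 l ^ 2 * log 2`.
    refine ⟨j + 1, by omega, hnk.le.trans (Nat.pow_le_pow_right (by norm_num) hkj), ?_⟩
    have hlog2 := Real.log_two_gt_d9
    have hlog2' := Real.log_two_lt_d9
    have hL1 : (2 : ℝ) ^ j * Real.log 2 ≤ Real.log n := by
      have e1 : ((2 : ℝ) ^ k) ≤ n := by exact_mod_cast hkn
      have e2 := Real.log_le_log (by positivity) e1
      rw [Real.log_pow] at e2
      have e3 : (2 : ℝ) ^ j ≤ k := by exact_mod_cast hjk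
      exact (mul_le_mul_of_nonneg_right e3 (by linarith)).trans e2
    have hL2 : (j : ℝ) * Real.log 2 - Real.log 2 ≤ Real.log (Real.log n) := by
      have e1 : (2 : ℝ) ^ j * 2⁻¹ ≤ Real.log n := by
        refine le_trans ?_ hL1
        gcongr
        linarith
      have e2 := Real.log_le_log (by positivity) e1
      rw [Real.log_mul (by positivity) (by norm_num), Real.log_pow, Real.log_inv] at e2
      linarith
    have hj1' : (10 : ℝ) ≤ j := by exact_mod_cast hj1
    have hL3 : ((j : ℝ) + 1) / 2 ≤ Real.log (Real.log n) := by nlinarith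
    have hexp : ((2 : ℝ) ^ (11 * (j + 1) ^ 2)) ≤
        Real.exp (300 * (Real.log (Real.log (n : ℝ))) ^ 2) := by
      rw [← Real.exp_log (show (0 : ℝ) < 2 ^ (11 * (j + 1) ^ 2) by positivity), Real.log_pow]
      refine Real.exp_le_exp.mpr ?_
      push_cast
      have e1 : (((j : ℝ) + 1) / 2) ^ 2 ≤ Real.log (Real.log n) ^ 2 := by gcongr
      nlinarith [sq_nonneg ((j : ℝ) + 1)]
    exact_mod_cast hexp.trans hm
  set K := 2 ^ l with hKdef
  have hK : 1000 ≤ K := by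
    have : 2 ^ 10 ≤ 2 ^ l := Nat.pow_le_pow_right (by norm_num) hl
    omega
  have hK' : (1000 : ℝ) ≤ K := by exact_mod_cast hK
  -- The truncation level `r = 10 l + 1` makes `2 ^ r = 2 K ^ 10`, while `K ^ r = 2 ^ (10 l ^ 2 +
  -- l)` stays below the length of the interval.
  have hr : Odd (10 * l + 1) := ⟨5 * l, by ring⟩
  have hbig : 6 * K ^ (10 * l + 3) ≤ m := by
    have e1 : 12 * K ^ (10 * l + 3) ≤ 2 ^ (11 * l ^ 2) := by
      rw [hKdef, ← pow_mul]
      calc 12 * 2 ^ (l * (10 * l + 3)) ≤ 2 ^ 4 * 2 ^ (l * (10 * l + 3)) := by gcongr; norm_num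
        _ = 2 ^ (4 + l * (10 * l + 3)) := by rw [pow_add]
        _ ≤ _ := Nat.pow_le_pow_right (by norm_num) (by nlinarith)
    omega
  have hbig' : 6 * (K : ℝ) ^ (10 * l + 3) ≤ m := by exact_mod_cast hbig
  have h1 : ((K : ℝ) + 1) ^ 2 / 2 ^ (10 * l + 1) ≤ 1 / (2 * K ^ 2) := by
    have e1 : (2 : ℝ) ^ (10 * l + 1) = 2 * (K : ℝ) ^ 10 := by
      rw [hKdef]; push_cast; ring
    rw [e1, div_le_div_iff₀ (by positivity) (by positivity)]
    have e2 : ((K : ℝ) + 1) ^ 2 ≤ (K : ℝ) ^ 4 := by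
      have : (K : ℝ) + 1 ≤ K ^ 2 := by nlinarith
      calc ((K : ℝ) + 1) ^ 2 ≤ ((K : ℝ) ^ 2) ^ 2 := by gcongr
        _ = (K : ℝ) ^ 4 := by ring
    have e3 : (K : ℝ) ^ 4 * K ^ 2 ≤ K ^ 10 := by
      rw [← pow_add]; exact pow_le_pow_right₀ (by linarith) (by norm_num)
    have e4 := mul_le_mul_of_nonneg_right e2 (sq_nonneg (K : ℝ))
    linarith
  have h2 : 3 * (K : ℝ) ^ (10 * l + 1) ≤ m / (2 * K ^ 2) := by
    rw [le_div_iff₀ (by positivity)]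
    refine le_trans (le_of_eq ?_) hbig'
    ring
  have h3 : ((K : ℝ) ^ 2 + 1) ^ 2 ≤ m / 100 := by
    have e1 : ((K : ℝ) ^ 2 + 1) ^ 2 ≤ (K : ℝ) ^ 6 := by
      have : (K : ℝ) ^ 2 + 1 ≤ K ^ 3 := by nlinarith [sq_nonneg (K : ℝ)]
      calc ((K : ℝ) ^ 2 + 1) ^ 2 ≤ ((K : ℝ) ^ 3) ^ 2 := by gcongr
        _ = (K : ℝ) ^ 6 := by ring
    have e2 : (K : ℝ) ^ 7 ≤ K ^ (10 * l + 3) := pow_le_pow_right₀ (by linarith) (by omega)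
    have e3 : (K : ℝ) ^ 7 = K * K ^ 6 := by ring
    have e4 : (0 : ℝ) ≤ K ^ 6 := by positivity
    nlinarith
  by_cases hAm : 2 * #A ≤ m
  · exact exists_no_common_odd_prime_of_card_le hK hr h1 h2 h3 hc
      (fun i hi => (hcn i hi).trans hnl) hA hB hA0 hAm hAB
  · have hBm : #B ≤ m := by simpa using card_le_card hB
    have hAm' : #A ≤ m := by simpa using card_le_card hA
    by_cases hB2 : 2 * #B ≤ m
    · obtain ⟨b, hb, a, ha, h⟩ := exists_no_common_odd_prime_of_card_le (c' := c) hK hr h1 h2 h3 hc'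
        (fun i hi => (hcn' i hi).trans hnl) hB hA hB0 hB2 (by omega)
      exact ⟨a, ha, b, hb, fun p hp hp2 h1 h2 => h p hp hp2 h2 h1⟩
    · have hm1 : 2 ≤ m := by
        have := Nat.one_le_pow (10 * l + 3) K (by omega)
        omega
      -- When both sets exceed `m / 2`, shrinking `A` to `m / 2` elements still leaves at least `m`
      -- in total.
      obtain ⟨A', hA'A, hA'⟩ := exists_subset_card_eq (show m / 2 ≤ #A by omega)
      obtain ⟨a, ha, h⟩ := exists_no_common_odd_prime_of_card_le (c' := c') hK hr h1 h2 h3 hc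
        (fun i hi => (hcn i hi).trans hnl) (hA'A.trans hA) hB (card_pos.mp (by omega))
        (by omega) (by omega)
      exact ⟨a, hA'A ha, h⟩

/-! ### Parity classes and the extremal configuration. -/

/-- The members of one parity class in an interval of length `2 m` are terms `c + 2 i`, `i < m`. -/
lemma exists_index_of_parity {n m e : ℕ} {I : Finset ℕ} (hI : I ⊆ Icc 1 n)
    (hI' : IsConsecutive I (2 * m)) (hm : 0 < m) :
    ∃ c, 1 ≤ c ∧ (∀ i < m, c + 2 * i ≤ n) ∧ ∀ x ∈ I, x % 2 = e → ∃ i < m, x = c + 2 * i := by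
  obtain ⟨a, rfl⟩ := hI'
  have ha := mem_Icc.mp (hI (mem_Ico.mpr ⟨le_refl a, by omega⟩))
  -- The first number from `a` on with the parity of `e`.
  refine ⟨a + (a + e) % 2, by omega, fun i hi => ?_, fun x hx hxe => ?_⟩
  · exact (mem_Icc.mp (hI (mem_Ico.mpr ⟨by omega, by omega⟩))).2
  · rw [mem_Ico] at hx
    exact ⟨(x - (a + (a + e) % 2)) / 2, by omega, by omega⟩

lemma exists_index_set {m c : ℕ} {X : Finset ℕ} (hX : ∀ x ∈ X, ∃ i < m, x = c + 2 * i) :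
    ∃ A ⊆ range m, #A = #X ∧ ∀ a ∈ A, c + 2 * a ∈ X := by
  refine ⟨{i ∈ range m | c + 2 * i ∈ X}, filter_subset _ _, ?_, fun a ha => (mem_filter.mp ha).2⟩
  refine card_bij (fun i _ => c + 2 * i) (fun i hi => (mem_filter.mp hi).2)
    (fun i _ j _ h => by simpa using h) fun x hx => ?_
  obtain ⟨i, hi, rfl⟩ := hX x hx
  exact ⟨i, mem_filter.mpr ⟨mem_range.mpr hi, hx⟩, rfl⟩

lemma card_le_of_parity {n m e : ℕ} {I X : Finset ℕ} (hI : I ⊆ Icc 1 n)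
    (hI' : IsConsecutive I (2 * m)) (hm : 0 < m) (hX : X ⊆ I)
    (hXe : ∀ x ∈ X, x % 2 = e) : #X ≤ m := by
  obtain ⟨c, -, -, hc⟩ := exists_index_of_parity (e := e) hI hI' hm
  obtain ⟨A, hA, hcard, -⟩ := exists_index_set fun x hx => hc x (hX hx) (hXe x hx)
  simpa [← hcard] using card_le_card hA

/-- Two parity classes that are not both even contain a coprime pair once they have at least `m`
elements together. -/
lemma exists_coprime_of_parity {n m e e' : ℕ} {I J X Y : Finset ℕ} (hn : 2 ^ 1024 ≤ n)
    (hI : I ⊆ Icc 1 n) (hJ : J ⊆ Icc 1 n)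
    (hI' : IsConsecutive I (2 * m)) (hJ' : IsConsecutive J (2 * m))
    (hm : Real.exp (300 * (Real.log (Real.log (n : ℝ))) ^ 2) ≤ ((2 * m : ℕ) : ℝ))
    (hee : e + e' ≠ 0) (hX : X ⊆ I) (hXe : ∀ x ∈ X, x % 2 = e)
    (hY : Y ⊆ J) (hYe : ∀ y ∈ Y, y % 2 = e') (hX0 : X.Nonempty) (hY0 : Y.Nonempty)
    (hXY : m ≤ #X + #Y) : ∃ x ∈ X, ∃ y ∈ Y, Nat.Coprime x y := by
  have hm0 : 0 < m := by
    rcases Nat.eq_zero_or_pos m with rfl | h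
    · have := Real.exp_pos (300 * (Real.log (Real.log (n : ℝ))) ^ 2)
      norm_num at hm
      linarith
    · exact h
  obtain ⟨c, hc1, hcn, hc⟩ := exists_index_of_parity (e := e) hI hI' hm0
  obtain ⟨c', hc1', hcn', hc'⟩ := exists_index_of_parity (e := e') hJ hJ' hm0
  obtain ⟨A, hA, hAX, hAm⟩ := exists_index_set fun x hx => hc x (hX hx) (hXe x hx)
  obtain ⟨B, hB, hBY, hBm⟩ := exists_index_set fun y hy => hc' y (hY hy) (hYe y hy)
  obtain ⟨a, ha, b, hb, h⟩ := exists_no_common_odd_prime hn hm hc1 hc1' hcn hcn' hA hB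
    (card_pos.mp (hAX ▸ hX0.card_pos)) (card_pos.mp (hBY ▸ hY0.card_pos)) (by omega)
  refine ⟨_, hAm a ha, _, hBm b hb, Nat.coprime_of_dvd fun p hp hpa hpb => ?_⟩
  rcases eq_or_ne p 2 with rfl | hp2
  · have h1 := hXe _ (hAm a ha)
    have h2 := hYe _ (hBm b hb)
    omega
  · exact h p hp hp2 hpa hpb

lemma eq_filter_even_of_forall_not_coprime {n m : ℕ} {I J S T : Finset ℕ} (hn : 2 ^ 1024 ≤ n)
    (hI : I ⊆ Icc 1 n) (hJ : J ⊆ Icc 1 n)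
    (hI' : IsConsecutive I (2 * m)) (hJ' : IsConsecutive J (2 * m))
    (hm : Real.exp (300 * (Real.log (Real.log (n : ℝ))) ^ 2) ≤ ((2 * m : ℕ) : ℝ)) (hm0 : 0 < m)
    (hS : S ⊆ I) (hT : T ⊆ J) (hST : 2 * m ≤ #S + #T) (hS0 : S ≠ ∅) (hT0 : T ≠ ∅)
    (hcop : ¬ ∃ s ∈ S, ∃ t ∈ T, Nat.Coprime s t) :
    S = I.filter (fun x => Even x) ∧ T = J.filter (fun x => Even x) := by
  have hmem : ∀ (U : Finset ℕ) (e : ℕ), ∀ x ∈ U.filter (· % 2 = e), x % 2 = e :=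
    fun U e x hx => (mem_filter.mp hx).2
  have key : ∀ e e', e + e' ≠ 0 → 0 < #(S.filter (· % 2 = e)) →
      0 < #(T.filter (· % 2 = e')) → #(S.filter (· % 2 = e)) + #(T.filter (· % 2 = e')) < m := by
    intro e e' hee h1 h2
    by_contra! hle
    obtain ⟨x, hx, y, hy, h⟩ := exists_coprime_of_parity hn hI hJ hI' hJ' hm hee
      ((filter_subset _ _).trans hS) (hmem S e) ((filter_subset _ _).trans hT) (hmem T e')
      (card_pos.mp h1) (card_pos.mp h2) hle
    exact hcop ⟨x, (mem_filter.mp hx).1, y, (mem_filter.mp hy).1, h⟩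
  have hcard : ∀ U : Finset ℕ, #U = #(U.filter (· % 2 = 0)) + #(U.filter (· % 2 = 1)) := by
    intro U
    rw [← card_filter_add_card_filter_not (s := U) (· % 2 = 0)]
    congr 2
    exact filter_congr fun x _ => by omega
  have hle : ∀ {I : Finset ℕ}, I ⊆ Icc 1 n → IsConsecutive I (2 * m) → ∀ U ⊆ I, ∀ e,
      #(U.filter (· % 2 = e)) ≤ m := fun hI hI' U hU e =>
    card_le_of_parity hI hI' hm0 ((filter_subset _ _).trans hU) (hmem U e)
  have k01 := key 0 1 (by norm_num)
  have k10 := key 1 0 (by norm_num)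
  have k11 := key 1 1 (by norm_num)
  have s0 := hle hI hI' S hS 0
  have s1 := hle hI hI' S hS 1
  have t0 := hle hJ hJ' T hT 0
  have t1 := hle hJ hJ' T hT 1
  have hSpos := card_pos.mpr (nonempty_iff_ne_empty.mpr hS0)
  have hTpos := card_pos.mpr (nonempty_iff_ne_empty.mpr hT0)
  have hSc := hcard S
  have hTc := hcard T
  -- If `S` and `T` both have odd elements, the odd parts total less than `m`, so both even parts
  -- are nonempty; the two mixed pairs then total less than `2 m`. If only `S` has odd elements, its
  -- odd part and `T` total less than `m`, and its even part adds at most `m`; symmetrically for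
  -- `T`. So there are no odd elements, and both even parts are full.
  have main : #(S.filter (· % 2 = 0)) = m ∧ #(S.filter (· % 2 = 1)) = 0 ∧
      #(T.filter (· % 2 = 0)) = m ∧ #(T.filter (· % 2 = 1)) = 0 := by omega
  have fin : ∀ {I U : Finset ℕ}, I ⊆ Icc 1 n → IsConsecutive I (2 * m) → U ⊆ I →
      #(U.filter (· % 2 = 0)) = m → #(U.filter (· % 2 = 1)) = 0 →
      U = I.filter (fun x => Even x) := by
    intro I U hI hI' hU h0 h1
    have hUm : #U = m := by rw [hcard U, h0, h1, add_zero]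
    refine eq_of_subset_of_card_le (fun x hx => mem_filter.mpr ⟨hU hx, ?_⟩) ?_
    · by_contra hodd
      have : x ∈ U.filter (· % 2 = 1) :=
        mem_filter.mpr ⟨hx, Nat.odd_iff.mp (Nat.not_even_iff_odd.mp hodd)⟩
      rw [card_eq_zero.mp h1] at this
      simp at this
    · rw [hUm]
      exact card_le_of_parity hI hI' hm0 (filter_subset _ _)
        fun x hx => Nat.even_iff.mp (mem_filter.mp hx).2
  exact ⟨fin hI hI' hS main.1 main.2.1, fin hJ hJ' hT main.2.2.1 main.2.2.2⟩

/-! ### Assembling the four alternatives. -/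

lemma existsUnique_fin_four {p q r s : Prop} (h : p ∨ q ∨ r ∨ s) (h01 : p → ¬ q) (h02 : p → ¬ r)
    (h03 : p → ¬ s) (h12 : q → ¬ r) (h13 : q → ¬ s) (h23 : r → ¬ s) :
    ∃! i : Fin 4, (![p, q, r, s] : Fin 4 → Prop) i := by
  rcases h with h | h | h | h
  · refine ⟨0, h, fun j hj => ?_⟩
    fin_cases j
    exacts [rfl, absurd hj (h01 h), absurd hj (h02 h), absurd hj (h03 h)]
  · refine ⟨1, h, fun j hj => ?_⟩
    fin_cases j
    exacts [absurd h (h01 hj), rfl, absurd hj (h12 h), absurd hj (h13 h)]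
  · refine ⟨2, h, fun j hj => ?_⟩
    fin_cases j
    exacts [absurd h (h02 hj), absurd h (h12 hj), rfl, absurd hj (h23 h)]
  · refine ⟨3, h, fun j hj => ?_⟩
    fin_cases j
    exacts [absurd h (h03 hj), absurd h (h13 hj), absurd h (h23 hj), rfl]

theorem mainTheorem2 :
    ∃ C : ℝ, ∃ N : ℕ, ∀ n : ℕ, N ≤ n →
      ∀ (m : ℕ) (I J : Finset ℕ),
        I ⊆ Finset.Icc 1 n → J ⊆ Finset.Icc 1 n →
        IsConsecutive I (2 * m) → IsConsecutive J (2 * m) →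
        Real.exp (C * (Real.log (Real.log (n : ℝ))) ^ 2) ≤ ((2 * m : ℕ) : ℝ) →
        ∀ S T : Finset ℕ, S ⊆ I → T ⊆ J → 2 * m ≤ S.card + T.card →
          (∃! i : Fin 4,
            (![S = ∅,
               T = ∅,
               S = I.filter (fun x => Even x) ∧ T = J.filter (fun x => Even x),
               ∃ s ∈ S, ∃ t ∈ T, Nat.Coprime s t] : Fin 4 → Prop) i) ∧
          (2 * m < S.card + T.card → ∃ s ∈ S, ∃ t ∈ T, Nat.Coprime s t) := by
  -- The threshold `2 ^ 1024` ensures `log₂ log₂ n ≥ 10`, which absorbs the numerical constants.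
  refine ⟨300, 2 ^ 1024, fun n hn m I J hI hJ hI' hJ' hm S T hS hT hST => ?_⟩
  have hm0 : 0 < m := by
    rcases Nat.eq_zero_or_pos m with rfl | h
    · have := Real.exp_pos (300 * (Real.log (Real.log (n : ℝ))) ^ 2)
      norm_num at hm
      linarith
    · exact h
  have hcardI : ∀ {I U : Finset ℕ}, IsConsecutive I (2 * m) → U ⊆ I → #U ≤ 2 * m := by
    rintro I U ⟨a, rfl⟩ hU
    simpa using card_le_card hU
  have heven : ∀ {I : Finset ℕ}, I ⊆ Icc 1 n → IsConsecutive I (2 * m) →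
      #(I.filter (fun x => Even x)) ≤ m := fun hI hI' =>
    card_le_of_parity hI hI' hm0 (filter_subset _ _)
      fun x hx => Nat.even_iff.mp (mem_filter.mp hx).2
  have hIe := heven hI hI'
  have hJe := heven hJ hJ'
  have h01 : S = ∅ → T ≠ ∅ := by rintro rfl rfl; simp at hST; omega
  have h02 : S = ∅ → ¬ (S = I.filter (fun x => Even x) ∧ T = J.filter (fun x => Even x)) := by
    rintro h ⟨-, h2⟩
    rw [h, card_empty, h2] at hST
    omega
  have h12 : T = ∅ → ¬ (S = I.filter (fun x => Even x) ∧ T = J.filter (fun x => Even x)) := by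
    rintro h ⟨h2, -⟩
    rw [h, card_empty, h2] at hST
    omega
  have h23 : (S = I.filter (fun x => Even x) ∧ T = J.filter (fun x => Even x)) →
      ¬ ∃ s ∈ S, ∃ t ∈ T, Nat.Coprime s t := by
    rintro ⟨hSe, hTe⟩ ⟨s, hs, t, ht, h⟩
    rw [hSe] at hs
    rw [hTe] at ht
    exact Nat.not_coprime_of_dvd_of_dvd one_lt_two (mem_filter.mp hs).2.two_dvd
      (mem_filter.mp ht).2.two_dvd h
  have h03 : S = ∅ → ¬ ∃ s ∈ S, ∃ t ∈ T, Nat.Coprime s t := by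
    rintro rfl; simp
  have h13 : T = ∅ → ¬ ∃ s ∈ S, ∃ t ∈ T, Nat.Coprime s t := by
    rintro rfl; simp
  have hkey : S ≠ ∅ → T ≠ ∅ → (¬ ∃ s ∈ S, ∃ t ∈ T, Nat.Coprime s t) →
      S = I.filter (fun x => Even x) ∧ T = J.filter (fun x => Even x) :=
    eq_filter_even_of_forall_not_coprime hn hI hJ hI' hJ' hm hm0 hS hT hST
  have hor : S = ∅ ∨ T = ∅ ∨ (S = I.filter (fun x => Even x) ∧ T = J.filter (fun x => Even x)) ∨
      ∃ s ∈ S, ∃ t ∈ T, Nat.Coprime s t :=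
    or_iff_not_imp_left.mpr fun h0 => or_iff_not_imp_left.mpr fun h1 =>
      or_iff_not_imp_right.mpr (hkey h0 h1)
  refine ⟨?_, fun hlt => ?_⟩
  · exact existsUnique_fin_four hor h01 h02 h03 h12 h13 h23
  · by_contra hcon
    rcases eq_or_ne S ∅ with h | hS0
    · rw [h, card_empty] at hlt
      have := hcardI hJ' hT
      omega
    rcases eq_or_ne T ∅ with h | hT0
    · rw [h, card_empty] at hlt
      have := hcardI hI' hS
      omega
    obtain ⟨h1, h2⟩ := hkey hS0 hT0 hcon
    rw [← h1] at hIe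
    rw [← h2] at hJe
    omega
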